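/- Let $G$ be the Barnes double gamma function, given by the Weierstrass canonical product $$G(1+x) = (2\pi)^{x/2} \exp\Bigl[-\tfrac12(\gamma x^2 + x^2 + x)\Bigr] \prod_{k=1}^{\infty} \Bigl\{\Bigl(1+\frac{x}{k}\Bigr)^k \exp\Bigl(\frac{x^2}{2k} - x\Bigr)\Bigr\},$$ where $\gamma$ is Euler's constant, and let $\zeta$ be the Riemann zeta function. Then for every real $t \ge 0$ the product defining $G(1+t)$ converges, $G(1+t) > 0$, the integral below converges absolutely, and $$\log G(1+t) = \frac12 t^2\Bigl(\log t - \frac32\Bigr) + \frac12 t \log(2\pi) + \zeta'(-1) - \int_0^\infty \frac{x \log(t^2+x^2)}{e^{2\pi x}-1}\,dx,$$ where $t^2\log t$ is read as $0$ for $t = 0$. In particular, for $t = 1$, $$\int_0^\infty \frac{x\log(1+x^2)}{e^{2\pi x}-1}\,dx = \frac12\log(2\pi) + \zeta'(-1) - \frac34 .$$ -/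

import Mathlib

/-- The `k`-th factor, `k = n + 1 ≥ 1`, of the Weierstrass canonical product of the Barnes
`G`-function at `1 + x`: `(1 + x / k) ^ k * exp (x ^ 2 / (2 k) - x)`. -/
noncomputable def barnesGFactor (x : ℝ) (n : ℕ) : ℝ :=
  (1 + x / ((n : ℝ) + 1)) ^ (n + 1) * Real.exp (x ^ 2 / (2 * ((n : ℝ) + 1)) - x)

/-- The Barnes double gamma function `G` (on the real line), by its Weierstrass canonical product
`G (1 + x) = (2π)^(x/2) exp (-(γ x² + x² + x)/2) ∏_{k ≥ 1} (1 + x/k)^k exp (x²/(2k) - x)`. -/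
noncomputable def barnesG (y : ℝ) : ℝ :=
  (2 * Real.pi) ^ ((y - 1) / 2) *
    Real.exp (-(1 / 2) *
      (Real.eulerMascheroniConstant * (y - 1) ^ 2 + (y - 1) ^ 2 + (y - 1))) *
    ∏' n : ℕ, barnesGFactor (y - 1) n

open Real MeasureTheory Set Filter Topology

/-- The weight `1 / (e ^ (2πx) - 1)` of the Abel–Plana and Binet formulas. -/
noncomputable def planckWeight (x : ℝ) : ℝ := (rexp (2 * π * x) - 1)⁻¹

lemma exp_two_pi_mul_sub_one_pos {x : ℝ} (hx : 0 < x) : 0 < rexp (2 * π * x) - 1 := by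
  have : 0 < 2 * π * x := by positivity
  linarith [add_one_lt_exp this.ne']

lemma planckWeight_pos {x : ℝ} (hx : 0 < x) : 0 < planckWeight x :=
  inv_pos.2 (exp_two_pi_mul_sub_one_pos hx)

lemma mul_planckWeight_le {x : ℝ} (hx : 0 < x) : x * planckWeight x ≤ rexp (-π * x) := by
  rw [planckWeight, ← div_eq_mul_inv, div_le_iff₀ (exp_two_pi_mul_sub_one_pos hx)]
  have h1 : π * x ≤ sinh (π * x) := self_le_sinh_iff.2 (by positivity)
  have h2 : rexp (-π * x) * (rexp (2 * π * x) - 1) = 2 * sinh (π * x) := by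
    rw [sinh_eq, mul_sub, ← exp_add]
    ring_nf
  have h3 : x ≤ π * x := by nlinarith [pi_gt_three]
  rw [h2]
  nlinarith

lemma continuousOn_planckWeight : ContinuousOn planckWeight (Ioi 0) := by
  unfold planckWeight
  exact ContinuousOn.inv₀ (by fun_prop) fun x hx => (exp_two_pi_mul_sub_one_pos hx).ne'

lemma measurable_planckWeight : Measurable planckWeight := by
  unfold planckWeight
  fun_prop

lemma hasSum_planckWeight {x : ℝ} (hx : 0 < x) :
    HasSum (fun n : ℕ => rexp (-(2 * π * (n + 1)) * x)) (planckWeight x) := by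
  have hr : rexp (-(2 * π * x)) < 1 := by
    rw [Real.exp_lt_one_iff]
    have : 0 < 2 * π * x := by positivity
    linarith
  have h := (hasSum_geometric_of_lt_one (exp_pos _).le hr).mul_left (rexp (-(2 * π * x)))
  have e1 : planckWeight x = rexp (-(2 * π * x)) * (1 - rexp (-(2 * π * x)))⁻¹ := by
    rw [planckWeight, ← inv_inv (rexp (-(2 * π * x))), ← exp_neg, neg_neg, ← mul_inv]
    congr 1
    field_simp
  rw [e1]
  refine h.congr_fun fun n => ?_
  rw [← exp_nat_mul, ← exp_add]
  ring_nf

lemma integrableOn_mul_planckWeight :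
    IntegrableOn (fun x => x * planckWeight x) (Ioi 0) := by
  refine Integrable.mono' (integrableOn_exp_mul_Ioi (neg_lt_zero.2 pi_pos) 0)
    (measurable_id.mul measurable_planckWeight).aestronglyMeasurable ?_
  refine (ae_restrict_mem measurableSet_Ioi).mono fun x (hx : 0 < x) => ?_
  rw [norm_of_nonneg (mul_pos hx (planckWeight_pos hx)).le]
  exact mul_planckWeight_le hx

lemma mellin_planckWeight {s : ℂ} (hs : 1 < s.re) :
    mellin (fun x => (planckWeight x : ℂ)) s =
      (2 * π : ℂ) ^ (-s) * Complex.Gamma s * riemannZeta s := by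
  have hp : ∀ n : ℕ, (0 : ℝ) < 2 * π * (n + 1) := fun n => by positivity
  have h := hasSum_mellin (a := fun _ : ℕ => 1) (p := fun n : ℕ => 2 * π * (n + 1))
    (F := fun x => (planckWeight x : ℂ)) (s := s) (fun n => Or.inr (hp n)) (by linarith)
    (fun t ht => by
      simp only [one_mul]
      exact_mod_cast hasSum_planckWeight ht) (by
      have h0 := (summable_nat_add_iff 1).2 (summable_one_div_nat_rpow.2 hs)
      refine (h0.mul_left ((2 * π) ^ (-s.re))).congr fun n => ?_
      rw [mul_rpow (x := 2 * π) (by positivity) (by positivity), rpow_neg (by positivity)]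
      push_cast
      rw [norm_one, ← one_div, div_mul_div_comm, one_mul])
  rw [← h.tsum_eq, zeta_eq_tsum_one_div_nat_add_one_cpow hs, ← tsum_mul_left]
  refine tsum_congr fun n => ?_
  have : ((2 * π * (n + 1) : ℝ) : ℂ) ^ s = (2 * π : ℂ) ^ s * (n + 1 : ℂ) ^ s := by
    have := Complex.mul_cpow_ofReal_nonneg (a := 2 * π) (b := n + 1) (by positivity)
      (by positivity) s
    push_cast at this ⊢
    exact this
  rw [this, Complex.cpow_neg]
  field_simp

lemma mellin_planckWeight_hasDerivAt_two :
    MellinConvergent (fun x => log x • (planckWeight x : ℂ)) 2 ∧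
      HasDerivAt (mellin fun x => (planckWeight x : ℂ))
        (mellin (fun x => log x • (planckWeight x : ℂ)) 2) 2 := by
  refine mellin_hasDerivAt_of_isBigO_rpow (a := 3) (b := 1) ?_ ?_ (by norm_num) ?_ (by norm_num)
  · exact (Complex.continuous_ofReal.comp_continuousOn
      continuousOn_planckWeight).locallyIntegrableOn measurableSet_Ioi
  · refine Asymptotics.IsBigO.trans (.of_bound 1 ?_)
      (isLittleO_exp_neg_mul_rpow_atTop pi_pos (-3)).isBigO
    filter_upwards [eventually_ge_atTop 1] with x hx
    have hx0 : 0 < x := by linarith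
    rw [Complex.norm_real, norm_of_nonneg (planckWeight_pos hx0).le,
      norm_of_nonneg (exp_pos _).le, one_mul]
    exact (le_mul_of_one_le_left (planckWeight_pos hx0).le hx).trans (mul_planckWeight_le hx0)
  · refine .of_bound 1 ?_
    filter_upwards [self_mem_nhdsWithin] with x (hx : 0 < x)
    rw [Complex.norm_real, norm_of_nonneg (planckWeight_pos hx).le, rpow_neg_one,
      norm_of_nonneg (inv_pos.2 hx).le, one_mul, ← one_div, le_div_iff₀ hx, mul_comm]
    exact (mul_planckWeight_le hx).trans (exp_le_one_iff.2 (by nlinarith [pi_pos]))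

lemma integrableOn_mul_log_mul_planckWeight :
    IntegrableOn (fun x => x * log x * planckWeight x) (Ioi 0) := by
  have h := mellin_planckWeight_hasDerivAt_two.1.norm
  refine Integrable.mono' h (by
    have := measurable_planckWeight
    exact Measurable.aestronglyMeasurable (by fun_prop)) ?_
  refine (ae_restrict_mem measurableSet_Ioi).mono fun x (hx : 0 < x) => le_of_eq ?_
  norm_num [abs_of_pos hx, mul_assoc]

/-- `ζ'(-1)` as a logarithmic moment of the weight `1 / (e ^ (2πx) - 1)`. -/
lemma deriv_riemannZeta_neg_one :
    deriv riemannZeta (-1) = ((2 * ∫ x in Ioi (0 : ℝ), x * log x * planckWeight x : ℝ) : ℂ) := by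
  have hM := mellin_planckWeight_hasDerivAt_two.2
  have hval : mellin (fun x => log x • (planckWeight x : ℂ)) 2 =
      ((∫ x in Ioi (0 : ℝ), x * log x * planckWeight x : ℝ) : ℂ) := by
    rw [mellin, ← integral_complex_ofReal]
    refine setIntegral_congr_fun measurableSet_Ioi fun x _ => ?_
    norm_num [mul_assoc]
  rw [hval] at hM
  set I := ∫ x in Ioi (0 : ℝ), x * log x * planckWeight x
  have hev : (fun s : ℂ => riemannZeta (1 - s)) =ᶠ[𝓝 2] fun s =>
      2 * Complex.cos (π * s / 2) * mellin (fun x => (planckWeight x : ℂ)) s := by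
    have : {s : ℂ | 1 < s.re} ∈ 𝓝 (2 : ℂ) :=
      (isOpen_lt continuous_const Complex.continuous_re).mem_nhds (by norm_num)
    filter_upwards [this] with s (hs : 1 < s.re)
    rw [riemannZeta_one_sub, mellin_planckWeight hs]
    · ring
    · rintro n rfl
      simp at hs
      have : (0 : ℝ) ≤ n := n.cast_nonneg
      linarith
    · rintro rfl
      simp at hs
  have hcos : HasDerivAt (fun s : ℂ => 2 * Complex.cos (π * s / 2)) 0 2 := by
    have h1 : HasDerivAt (fun s : ℂ => (π : ℂ) * s / 2) (π * 1 / 2) 2 :=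
      ((hasDerivAt_id (2 : ℂ)).const_mul (π : ℂ)).div_const 2
    convert! (h1.ccos.const_mul 2) using 1
    simp
  have h1 := (hcos.mul hM).congr_of_eventuallyEq hev
  have h2 : HasDerivAt riemannZeta (deriv riemannZeta (-1)) (1 - 2) := by
    rw [show (1 - 2 : ℂ) = -1 by norm_num]
    exact (differentiableAt_riemannZeta (by norm_num)).hasDerivAt
  have h3 : HasDerivAt (fun s : ℂ => riemannZeta (1 - s)) (deriv riemannZeta (-1) * -1) 2 :=
    h2.comp 2 ((hasDerivAt_id (2 : ℂ)).const_sub 1)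
  have h4 := h3.unique h1
  simp at h4
  push_cast
  linear_combination h4

lemma integral_exp_neg_mul_sin {a : ℝ} (ha : 0 < a) (u : ℝ) :
    ∫ x in Ioi (0 : ℝ), rexp (-a * x) * sin (u * x) = u / (a ^ 2 + u ^ 2) := by
  have hre : (-a + u * Complex.I : ℂ).re < 0 := by simpa using ha
  have h := integral_exp_mul_complex_Ioi hre 0
  have him := integral_im (𝕜 := ℂ) (integrableOn_exp_mul_complex_Ioi hre 0)
  rw [h] at him
  have e : ∀ x : ℝ, RCLike.im (Complex.exp ((-a + u * Complex.I : ℂ) * x)) =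
      rexp (-a * x) * sin (u * x) := fun x => by
    simp [Complex.exp_im]
  simp_rw [e] at him
  rw [him]
  have hne : a ^ 2 + u ^ 2 ≠ 0 := by positivity
  simp [Complex.div_im, Complex.normSq_apply]
  field_simp

lemma tsum_two_mul_div_sq_add_sq {u : ℝ} (hu : 0 < u) :
    ∑' n : ℕ, 2 * (u / ((2 * π * (n + 1)) ^ 2 + u ^ 2)) = (rexp u - 1)⁻¹ + 1 / 2 - 1 / u := by
  have hu' : (u : ℂ) ≠ 0 := by exact_mod_cast hu.ne'
  have hpi : (π : ℂ) ≠ 0 := by exact_mod_cast pi_ne_zero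
  set z : ℂ := Complex.I * (u / (2 * π) : ℝ) with hz
  have hzim : 0 < z.im := by
    rw [hz]
    simp only [Complex.mul_im, Complex.I_re, Complex.I_im, Complex.ofReal_re, Complex.ofReal_im]
    rw [zero_mul, zero_add, one_mul]
    positivity
  have h := cot_series_rep' (UpperHalfPlane.coe_mem_integerComplement ⟨z, hzim⟩)
  simp only at h
  rw [Complex.cot_eq_exp_ratio] at h
  have e1 : 2 * Complex.I * (π * z) = ((-u : ℝ) : ℂ) := by
    rw [hz]
    push_cast
    field_simp
    rw [Complex.I_sq]
  have e2 : ∀ n : ℕ, 1 / (z - (n + 1)) + 1 / (z + (n + 1)) =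
      -2 * π * Complex.I * ((2 * (u / ((2 * π * (n + 1)) ^ 2 + u ^ 2)) : ℝ) : ℂ) := fun n => by
    have hn : ∀ s : ℝ, z + s ≠ 0 := fun s hs => by
      have := congrArg Complex.im hs
      simp at this
      linarith
    have h1 : z - (n + 1) ≠ 0 := by
      have := hn (-(n + 1))
      push_cast at this
      rwa [sub_eq_add_neg]
    have h2 : z + (n + 1) ≠ 0 := by
      have := hn (n + 1)
      push_cast at this
      exact this
    have h3 : (2 * π * (n + 1)) ^ 2 + u ^ 2 ≠ (0 : ℂ) := by
      have : (2 * π * (n + 1)) ^ 2 + u ^ 2 ≠ (0 : ℝ) := by positivity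
      exact_mod_cast this
    have h4 : (z - (n + 1)) * (z + (n + 1)) * (2 * π) ^ 2 = -((2 * π * (n + 1)) ^ 2 + u ^ 2) := by
      have : z * (2 * π) = Complex.I * u := by
        rw [hz]
        push_cast
        field_simp
      linear_combination (z * (2 * π) + Complex.I * u) * this + u ^ 2 * Complex.I_sq
    have h5 : z * (2 * π) = Complex.I * u := by
      rw [hz]
      push_cast
      field_simp
    push_cast
    rw [div_add_div _ _ h1 h2, ← mul_div_mul_right _ _ (pow_ne_zero 2 (mul_ne_zero two_ne_zero hpi)),
      h4, div_eq_iff (neg_ne_zero.2 h3)]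
    linear_combination 4 * (π : ℂ) * h5 - 4 * (π : ℂ) * Complex.I * div_mul_cancel₀ (u : ℂ) h3
  simp_rw [e2] at h
  rw [tsum_mul_left, ← Complex.ofReal_tsum, e1, ← Complex.ofReal_exp] at h
  have h6 : rexp (-u) = (rexp u)⁻¹ := exp_neg u
  have h7 : 0 < rexp u - 1 := by linarith [add_one_lt_exp hu.ne']
  have h7' : (rexp u : ℂ) - 1 ≠ 0 := by exact_mod_cast h7.ne'
  have h8 : (rexp u : ℂ) ≠ 0 := by exact_mod_cast (exp_pos u).ne'
  have h9 : 1 - (rexp (-u) : ℂ) ≠ 0 := by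
    have : 1 - rexp (-u) ≠ 0 := by
      have : rexp (-u) < 1 := Real.exp_lt_one_iff.2 (by linarith)
      linarith
    exact_mod_cast this
  have h10 : ((rexp (-u) : ℂ) + 1) / (Complex.I * (1 - (rexp (-u) : ℂ))) =
      -Complex.I * ((rexp u + 1) / (rexp u - 1)) := by
    rw [div_eq_iff (mul_ne_zero Complex.I_ne_zero h9), h6]
    push_cast [-Complex.ofReal_exp]
    field_simp
    rw [Complex.I_sq]
    ring
  have h11 : 1 / z = -Complex.I * (2 * π / u) := by
    rw [hz]
    push_cast
    field_simp
    rw [Complex.I_sq]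
    ring
  rw [h10, h11] at h
  have key : ((∑' n : ℕ, 2 * (u / ((2 * π * (n + 1)) ^ 2 + u ^ 2)) : ℝ) : ℂ) =
      (((rexp u - 1)⁻¹ + 1 / 2 - 1 / u : ℝ) : ℂ) := by
    refine mul_left_cancel₀ (mul_ne_zero (mul_ne_zero (neg_ne_zero.2 two_ne_zero) hpi)
      Complex.I_ne_zero) (h.symm.trans ?_)
    push_cast [-Complex.ofReal_exp]
    field_simp
    ring
  exact_mod_cast key

lemma integral_sin_mul_planckWeight {u : ℝ} (hu : 0 < u) :
    ∫ x in Ioi (0 : ℝ), 2 * (sin (u * x) * planckWeight x) =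
      (rexp u - 1)⁻¹ + 1 / 2 - 1 / u := by
  have hs : HasSum (fun n : ℕ => ∫ x in Ioi (0 : ℝ),
      2 * (sin (u * x) * rexp (-(2 * π * (n + 1)) * x)))
      (∫ x in Ioi (0 : ℝ), 2 * (sin (u * x) * planckWeight x)) := by
    refine hasSum_integral_of_dominated_convergence
      (fun (n : ℕ) x => 2 * (u * x) * rexp (-(2 * π * (n + 1)) * x)) ?_ ?_ ?_ ?_ ?_
    · exact fun n => Continuous.aestronglyMeasurable (by fun_prop)
    · refine fun n => (ae_restrict_mem measurableSet_Ioi).mono fun x (hx : 0 < x) => ?_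
      have h0 : 0 ≤ u * x := by positivity
      have h1 : |sin (u * x)| ≤ u * x := (abs_sin_le_abs).trans_eq (abs_of_nonneg h0)
      rw [norm_mul, norm_mul, norm_of_nonneg (exp_pos _).le, norm_of_nonneg zero_le_two, norm_eq_abs]
      linarith [mul_le_mul_of_nonneg_right h1 (exp_pos (-(2 * π * (n + 1)) * x)).le]
    · exact (ae_restrict_mem measurableSet_Ioi).mono fun x (hx : 0 < x) =>
        (hasSum_planckWeight hx).summable.mul_left _
    · refine (integrableOn_mul_planckWeight.const_mul (2 * u)).congr ?_
      refine (ae_restrict_mem measurableSet_Ioi).mono fun x (hx : 0 < x) => ?_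
      simp only
      rw [tsum_mul_left, (hasSum_planckWeight hx).tsum_eq]
      ring
    · exact (ae_restrict_mem measurableSet_Ioi).mono fun x (hx : 0 < x) =>
        ((hasSum_planckWeight hx).mul_left _).mul_left _
  rw [← hs.tsum_eq, ← tsum_two_mul_div_sq_add_sq hu]
  refine tsum_congr fun n => ?_
  rw [integral_const_mul, ← integral_exp_neg_mul_sin (by positivity)]
  simp_rw [mul_comm (sin _)]

/-- The integral in Binet's second formula for the digamma function. -/
noncomputable def binetIntegral (t : ℝ) : ℝ :=
  ∫ x in Ioi (0 : ℝ), 2 * x / (t ^ 2 + x ^ 2) * planckWeight x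

lemma binetIntegral_laplace {t : ℝ} (ht : 0 < t) :
    IntegrableOn (fun u => rexp (-t * u) * ((rexp u - 1)⁻¹ + 1 / 2 - 1 / u)) (Ioi 0) ∧
    binetIntegral t =
      ∫ u in Ioi (0 : ℝ), rexp (-t * u) * ((rexp u - 1)⁻¹ + 1 / 2 - 1 / u) := by
  set F : ℝ → ℝ → ℝ := fun x u => 2 * (rexp (-t * u) * sin (u * x)) * planckWeight x with hF
  have hexp : IntegrableOn (fun u => u * rexp (-t * u)) (Ioi 0) := by
    have := integrableOn_rpow_mul_exp_neg_mul_rpow (s := 1) (p := 1) (b := t) (by norm_num)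
      one_pos ht
    simpa using this
  have hint : Integrable (Function.uncurry F)
      ((volume.restrict (Ioi 0)).prod (volume.restrict (Ioi 0))) := by
    refine Integrable.mono' (integrableOn_mul_planckWeight.mul_prod (hexp.const_mul 2)) ?_ ?_
    · have := measurable_planckWeight
      refine Measurable.aestronglyMeasurable ?_
      simp only [hF, Function.uncurry_def]
      fun_prop
    · rw [Measure.prod_restrict]
      refine (ae_restrict_mem (measurableSet_Ioi.prod measurableSet_Ioi)).mono ?_
      rintro ⟨x, u⟩ ⟨hx : 0 < x, hu : 0 < u⟩
      have h0 : 0 ≤ u * x := by positivity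
      have h1 : |sin (u * x)| ≤ u * x := (abs_sin_le_abs).trans_eq (abs_of_nonneg h0)
      have hw := planckWeight_pos hx
      simp only [hF, Function.uncurry_apply_pair]
      rw [norm_mul, norm_mul, norm_mul, norm_of_nonneg (exp_pos _).le, norm_of_nonneg zero_le_two,
        norm_of_nonneg hw.le]
      calc 2 * (rexp (-t * u) * ‖sin (u * x)‖) * planckWeight x
          ≤ 2 * (rexp (-t * u) * (u * x)) * planckWeight x := by
            gcongr
            exact h1
        _ = x * planckWeight x * (2 * (u * rexp (-t * u))) := by ring
  have hS : ∀ u ∈ Ioi (0 : ℝ), ∫ x in Ioi (0 : ℝ), F x u =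
      rexp (-t * u) * ((rexp u - 1)⁻¹ + 1 / 2 - 1 / u) := fun u hu => by
    rw [← integral_sin_mul_planckWeight hu, ← integral_const_mul]
    congr 1 with x
    simp only [hF]
    ring
  have hL : ∀ x ∈ Ioi (0 : ℝ), ∫ u in Ioi (0 : ℝ), F x u =
      2 * x / (t ^ 2 + x ^ 2) * planckWeight x := fun x hx => by
    simp only [hF]
    rw [integral_mul_const, integral_const_mul, mul_div_assoc, ← integral_exp_neg_mul_sin ht]
    simp_rw [mul_comm x]
  constructor
  · exact (hint.integral_prod_right).congr
      ((ae_restrict_mem measurableSet_Ioi).mono fun u hu => hS u hu)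
  · rw [← setIntegral_congr_fun measurableSet_Ioi hS, ← integral_integral_swap hint, binetIntegral,
      ← setIntegral_congr_fun measurableSet_Ioi hL]

lemma binetIntegral_sub_add_one {t : ℝ} (ht : 0 < t) :
    binetIntegral t - binetIntegral (t + 1) =
      1 / (t + 1) + (1 / t - 1 / (t + 1)) / 2 - log ((t + 1) / t) := by
  have ht1 : 0 < t + 1 := by linarith
  obtain ⟨hi, he⟩ := binetIntegral_laplace ht
  obtain ⟨hi1, he1⟩ := binetIntegral_laplace ht1
  have hE := integrableOn_exp_mul_Ioi (neg_lt_zero.2 ht) 0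
  have hE1 := integrableOn_exp_mul_Ioi (neg_lt_zero.2 ht1) 0
  have hv : ∀ s : ℝ, 0 < s → ∫ u in Ioi (0 : ℝ), rexp (-s * u) = 1 / s := fun s hs => by
    rw [integral_exp_mul_Ioi (neg_lt_zero.2 hs)]
    simp
  have hA : IntegrableOn (fun u => rexp (-(t + 1) * u) +
      (rexp (-t * u) - rexp (-(t + 1) * u)) / 2) (Ioi 0) := hE1.add ((hE.sub hE1).div_const 2)
  have hpt : ∀ u ∈ Ioi (0 : ℝ),
      u⁻¹ • ((fun x => rexp (-x)) (t * u) - (fun x => rexp (-x)) ((t + 1) * u)) =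
      (rexp (-(t + 1) * u) + (rexp (-t * u) - rexp (-(t + 1) * u)) / 2) -
      (rexp (-t * u) * ((rexp u - 1)⁻¹ + 1 / 2 - 1 / u) -
        rexp (-(t + 1) * u) * ((rexp u - 1)⁻¹ + 1 / 2 - 1 / u)) := by
    intro u (hu : 0 < u)
    have h1 : rexp u - 1 ≠ 0 := by linarith [add_one_lt_exp hu.ne']
    have h2 : rexp (-t * u) = rexp (-(t + 1) * u) * rexp u := by
      rw [← exp_add]
      ring_nf
    simp only [smul_eq_mul, ← neg_mul]
    rw [h2]
    field_simp
    ring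
  have hint : IntegrableOn (fun u =>
      u⁻¹ • ((fun x => rexp (-x)) (t * u) - (fun x => rexp (-x)) ((t + 1) * u))) (Ioi 0) :=
    (integrableOn_congr_fun hpt measurableSet_Ioi).2 (hA.sub (hi.sub hi1))
  have hfr := Frullani.integral_Ioi_eq (f := fun x => rexp (-x)) (L := 1) (R := 0)
    ((Continuous.locallyIntegrable (by fun_prop)).locallyIntegrableOn _) ht ht1
    ((Continuous.tendsto' (by fun_prop) 0 1 (by simp)).mono_left nhdsWithin_le_nhds)
    tendsto_exp_neg_atTop_nhds_zero hint
  have hsub := integral_sub hA (hi.sub hi1)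
  have hadd := integral_add hE1 ((hE.sub hE1).div_const 2)
  simp only [Pi.sub_apply] at hsub hadd
  rw [setIntegral_congr_fun measurableSet_Ioi hpt, hsub,
    hadd, integral_div, integral_sub hE hE1,
    integral_sub hi hi1, ← he, ← he1, hv t ht, hv _ ht1] at hfr
  simp only [sub_zero, smul_eq_mul, mul_one] at hfr
  linarith

lemma binetIntegrand_bounds {t x : ℝ} (ht : 0 < t) (hx : 0 < x) :
    0 ≤ 2 * x / (t ^ 2 + x ^ 2) * planckWeight x ∧
    2 * x / (t ^ 2 + x ^ 2) * planckWeight x ≤ 2 / t ^ 2 * (x * planckWeight x) := by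
  have hw := planckWeight_pos hx
  refine ⟨by positivity, ?_⟩
  calc 2 * x / (t ^ 2 + x ^ 2) * planckWeight x ≤ 2 * x / t ^ 2 * planckWeight x := by
        gcongr
        nlinarith
    _ = _ := by ring

lemma tendsto_binetIntegral_atTop : Tendsto binetIntegral atTop (𝓝 0) := by
  have hlim : Tendsto (fun t : ℝ => 2 / t ^ 2 * ∫ x in Ioi (0 : ℝ), x * planckWeight x) atTop
      (𝓝 0) := by
    have := (tendsto_const_nhds (x := (2 : ℝ))).div_atTop
      (tendsto_pow_atTop (α := ℝ) two_ne_zero)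
    simpa using this.mul_const (∫ x in Ioi (0 : ℝ), x * planckWeight x)
  refine tendsto_of_tendsto_of_tendsto_of_le_of_le' tendsto_const_nhds hlim ?_ ?_
  · filter_upwards [eventually_gt_atTop 0] with t ht
    exact setIntegral_nonneg measurableSet_Ioi fun x hx => (binetIntegrand_bounds ht hx).1
  · filter_upwards [eventually_gt_atTop 0] with t ht
    rw [← integral_const_mul]
    refine integral_mono_of_nonneg ?_ (integrableOn_mul_planckWeight.const_mul _) ?_
    · exact (ae_restrict_mem measurableSet_Ioi).mono fun x hx => (binetIntegrand_bounds ht hx).1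
    · exact (ae_restrict_mem measurableSet_Ioi).mono fun x hx => (binetIntegrand_bounds ht hx).2

/-- Binet's second formula, for the partial fraction expansion of the digamma function. -/
lemma hasSum_one_div_sub_one_div {t : ℝ} (ht : 0 < t) :
    HasSum (fun k : ℕ => 1 / ((k : ℝ) + 1) - 1 / ((k : ℝ) + 1 + t))
      (eulerMascheroniConstant + log t + 1 / (2 * t) - binetIntegral t) := by
  have hnn : ∀ k : ℕ, 0 ≤ 1 / ((k : ℝ) + 1) - 1 / ((k : ℝ) + 1 + t) := fun k => by
    rw [sub_nonneg]
    exact one_div_le_one_div_of_le (by positivity) (by linarith)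
  rw [hasSum_iff_tendsto_nat_of_nonneg hnn]
  have hsum : ∀ N : ℕ, ∑ k ∈ Finset.range N, (1 / ((k : ℝ) + 1) - 1 / ((k : ℝ) + 1 + t)) =
      harmonic N - (log (t + N) + 1 / (2 * (t + N)) - binetIntegral (t + N)) +
        (log t + 1 / (2 * t) - binetIntegral t) := by
    intro N
    induction N with
    | zero => simp
    | succ N ih =>
      have hp : 0 < t + N := by positivity
      have h := binetIntegral_sub_add_one hp
      rw [log_div (by positivity) hp.ne'] at h
      rw [Finset.sum_range_succ, ih, harmonic_succ]
      push_cast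
      rw [← add_assoc t (N : ℝ) 1, add_right_comm (N : ℝ) 1 t, add_comm (N : ℝ) t, ← one_div]
      have e : 1 / (2 * (t + N)) = 1 / (t + N) / 2 := by field_simp
      have e' : 1 / (2 * (t + N + 1)) = 1 / (t + N + 1) / 2 := by field_simp
      rw [e, e']
      linarith
  simp_rw [hsum]
  have hN : Tendsto (fun N : ℕ => t + (N : ℝ)) atTop atTop :=
    tendsto_atTop_add_const_left _ _ tendsto_natCast_atTop_atTop
  have h1 : Tendsto (fun N : ℕ => log (t + N) - log N) atTop (𝓝 0) := by
    have h2 : Tendsto (fun N : ℕ => 1 + t / (N : ℝ)) atTop (𝓝 (1 + 0)) :=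
      (tendsto_const_div_atTop_nhds_zero_nat t).const_add 1
    rw [add_zero] at h2
    have h3 := h2.log one_ne_zero
    rw [log_one] at h3
    refine h3.congr' ?_
    filter_upwards [eventually_gt_atTop 0] with N hN0
    have : (0 : ℝ) < N := by exact_mod_cast hN0
    rw [← log_div (by positivity) this.ne']
    congr 1
    field_simp
    ring
  have h2 : Tendsto (fun N : ℕ => 1 / (2 * (t + (N : ℝ)))) atTop (𝓝 0) :=
    tendsto_const_nhds.div_atTop (hN.const_mul_atTop two_pos)
  have h := ((((tendsto_harmonic_sub_log.sub h1).sub h2).add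
    (tendsto_binetIntegral_atTop.comp hN)).add_const (log t + 1 / (2 * t) - binetIntegral t))
  convert! h using 1
  · ext N
    simp only [Function.comp]
    ring
  · ring_nf

/-- The logarithm of a factor of the Weierstrass product of the Barnes `G`-function. -/
noncomputable def logBarnesGFactor (n : ℕ) (t : ℝ) : ℝ :=
  (n + 1) * log (1 + t / (n + 1)) + (t ^ 2 / (2 * (n + 1)) - t)

lemma one_add_div_nat_add_one_pos {t : ℝ} (ht : -1 < t) (n : ℕ) : 0 < 1 + t / ((n : ℝ) + 1) := by
  have hn : (0 : ℝ) ≤ n := n.cast_nonneg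
  have e : 1 + t / ((n : ℝ) + 1) = ((n : ℝ) + 1 + t) / (n + 1) := by field_simp
  rw [e]
  apply div_pos <;> linarith

lemma barnesGFactor_pos {t : ℝ} (ht : -1 < t) (n : ℕ) : 0 < barnesGFactor t n :=
  mul_pos (pow_pos (one_add_div_nat_add_one_pos ht n) _) (exp_pos _)

lemma log_barnesGFactor {t : ℝ} (ht : -1 < t) (n : ℕ) :
    log (barnesGFactor t n) = logBarnesGFactor n t := by
  rw [barnesGFactor, log_mul (pow_pos (one_add_div_nat_add_one_pos ht n) _).ne' (exp_pos _).ne',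
    log_pow, log_exp, logBarnesGFactor]
  push_cast
  rfl

lemma hasDerivAt_logBarnesGFactor {t : ℝ} (ht : -1 < t) (n : ℕ) :
    HasDerivAt (logBarnesGFactor n) (t * (1 / ((n : ℝ) + 1) - 1 / ((n : ℝ) + 1 + t))) t := by
  have hp := one_add_div_nat_add_one_pos ht n
  have hn : (0 : ℝ) ≤ n := n.cast_nonneg
  have h1 : (n : ℝ) + 1 + t ≠ 0 := by linarith
  have h2 : (n : ℝ) + 1 ≠ 0 := by positivity
  have hlog := ((((hasDerivAt_id t).div_const ((n : ℝ) + 1)).const_add 1).log hp.ne').const_mul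
    ((n : ℝ) + 1)
  have h := hlog.add ((((hasDerivAt_id t).pow 2).div_const (2 * ((n : ℝ) + 1))).sub
    (hasDerivAt_id t))
  have e : 1 + t / ((n : ℝ) + 1) = ((n : ℝ) + 1 + t) / (n + 1) := by field_simp
  convert! h using 1
  simp only [id]
  rw [e]
  field_simp
  ring

lemma logBarnesGFactor_zero (n : ℕ) : logBarnesGFactor n 0 = 0 := by
  simp [logBarnesGFactor]

lemma logBarnesGFactor_series {t : ℝ} (ht : -(1 / 2) < t) :
    Summable (logBarnesGFactor · t) ∧
    HasDerivAt (fun s => ∑' n, logBarnesGFactor n s)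
      (∑' n : ℕ, t * (1 / ((n : ℝ) + 1) - 1 / ((n : ℝ) + 1 + t))) t := by
  set T : ℝ := |t| + 1 with hT
  have hT1 : 1 ≤ T := by linarith [abs_nonneg t]
  have hu : Summable fun n : ℕ => 2 * T ^ 2 * (1 / ((n + 1 : ℕ) : ℝ) ^ 2) :=
    ((summable_nat_add_iff 1).2 (summable_one_div_nat_pow.2 one_lt_two)).mul_left _
  have hb : ∀ (n : ℕ) (y : ℝ), y ∈ Ioo (-(1 / 2)) T →
      ‖y * (1 / ((n : ℝ) + 1) - 1 / ((n : ℝ) + 1 + y))‖ ≤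
        2 * T ^ 2 * (1 / ((n + 1 : ℕ) : ℝ) ^ 2) := by
    rintro n y ⟨hy1, hy2⟩
    have hn : (0 : ℝ) ≤ n := n.cast_nonneg
    have h1 : ((n : ℝ) + 1) / 2 ≤ (n : ℝ) + 1 + y := by linarith
    have h2 : 0 < (n : ℝ) + 1 + y := by linarith
    have h3 : y * (1 / ((n : ℝ) + 1) - 1 / ((n : ℝ) + 1 + y)) =
        y ^ 2 / (((n : ℝ) + 1) * ((n : ℝ) + 1 + y)) := by
      field_simp
      ring
    have h4 : y ^ 2 ≤ T ^ 2 := sq_le_sq' (by linarith) hy2.le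
    rw [h3, norm_of_nonneg (by positivity)]
    calc y ^ 2 / (((n : ℝ) + 1) * ((n : ℝ) + 1 + y))
        ≤ T ^ 2 / (((n : ℝ) + 1) * (((n : ℝ) + 1) / 2)) := by gcongr
      _ = _ := by
        push_cast
        field_simp
  have h0 : (0 : ℝ) ∈ Ioo (-(1 / 2)) T := ⟨by norm_num, by linarith⟩
  have ht' : t ∈ Ioo (-(1 / 2)) T := ⟨ht, by linarith [le_abs_self t]⟩
  have hs0 : Summable fun n => logBarnesGFactor n 0 := by
    simp_rw [logBarnesGFactor_zero]
    exact summable_zero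
  have hd : ∀ (n : ℕ) (y : ℝ), y ∈ Ioo (-(1 / 2)) T → HasDerivAt (logBarnesGFactor n)
      (y * (1 / ((n : ℝ) + 1) - 1 / ((n : ℝ) + 1 + y))) y :=
    fun n y hy => hasDerivAt_logBarnesGFactor (by linarith [hy.1]) n
  exact ⟨summable_of_summable_hasDerivAt_of_isPreconnected hu isOpen_Ioo isPreconnected_Ioo hd hb
      h0 hs0 ht',
    hasDerivAt_tsum_of_isPreconnected hu isOpen_Ioo isPreconnected_Ioo hd hb h0 hs0 ht'⟩

lemma multipliable_barnesGFactor {t : ℝ} (ht : -(1 / 2) < t) : Multipliable (barnesGFactor t) := by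
  refine Real.multipliable_of_summable_log (barnesGFactor_pos (by linarith)) ?_
  simp_rw [log_barnesGFactor (show -1 < t by linarith)]
  exact (logBarnesGFactor_series ht).1

lemma barnesG_one_add_eq {t : ℝ} (ht : -(1 / 2) < t) :
    barnesG (1 + t) = (2 * π) ^ (t / 2) *
      rexp (-(1 / 2) * (eulerMascheroniConstant * t ^ 2 + t ^ 2 + t)) *
        rexp (∑' n, logBarnesGFactor n t) := by
  have h := Real.rexp_tsum_eq_tprod (f := barnesGFactor t) (barnesGFactor_pos (by linarith)) (by
    simp_rw [log_barnesGFactor (show -1 < t by linarith)]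
    exact (logBarnesGFactor_series ht).1)
  simp_rw [log_barnesGFactor (show -1 < t by linarith)] at h
  rw [barnesG, add_sub_cancel_left, h]

lemma barnesG_one_add_pos {t : ℝ} (ht : -(1 / 2) < t) : 0 < barnesG (1 + t) := by
  rw [barnesG_one_add_eq ht]
  positivity

lemma log_barnesG_one_add {t : ℝ} (ht : -(1 / 2) < t) :
    log (barnesG (1 + t)) = t / 2 * log (2 * π) -
      1 / 2 * (eulerMascheroniConstant * t ^ 2 + t ^ 2 + t) + ∑' n, logBarnesGFactor n t := by
  rw [barnesG_one_add_eq ht, log_mul (by positivity) (by positivity),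
    log_mul (by positivity) (by positivity), log_exp, log_exp, log_rpow (by positivity)]
  ring

lemma log_barnesG_one : log (barnesG (1 + 0)) = 0 := by
  rw [log_barnesG_one_add (by norm_num)]
  simp [logBarnesGFactor_zero]

lemma log_barnesG_two : log (barnesG (1 + 1)) = 0 := by
  have hsum : ∀ N : ℕ, ∑ n ∈ Finset.range N, logBarnesGFactor n 1 =
      N * log (N + 1) - log (N.factorial) + harmonic N / 2 - N := by
    intro N
    induction N with
    | zero => simp
    | succ N ih =>
      have h1 : 1 + 1 / ((N : ℝ) + 1) = ((N : ℝ) + 1 + 1) / (N + 1) := by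
        field_simp
      rw [Finset.sum_range_succ, ih, logBarnesGFactor, harmonic_succ, Nat.factorial_succ, h1,
        log_div (by positivity) (by positivity)]
      push_cast
      rw [log_mul (by positivity) (by positivity)]
      field_simp
      ring
  have hlim := (logBarnesGFactor_series (t := 1) (by norm_num)).1.hasSum.tendsto_sum_nat
  simp_rw [hsum] at hlim
  have hst := Stirling.tendsto_stirlingSeq_sqrt_pi.log (by positivity)
  have hmul : Tendsto (fun N : ℕ => (N : ℝ) * log (1 + 1 / N)) atTop (𝓝 1) :=
    (tendsto_mul_log_one_add_div_atTop 1).comp tendsto_natCast_atTop_atTop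
  have hlim2 := ((hmul.sub hst).add (tendsto_harmonic_sub_log.div_const 2)).sub_const
    (1 / 2 * log 2)
  have heq : (fun N : ℕ => (N : ℝ) * log (1 + 1 / N) - log (Stirling.stirlingSeq N) +
      ((harmonic N : ℝ) - log N) / 2 - 1 / 2 * log 2) =ᶠ[atTop] fun N : ℕ =>
        (N : ℝ) * log (N + 1) - log (N.factorial) + harmonic N / 2 - N := by
    filter_upwards [eventually_gt_atTop 0] with N hN
    have hN' : (0 : ℝ) < N := by exact_mod_cast hN
    have h1 : 1 + 1 / (N : ℝ) = ((N : ℝ) + 1) / N := by field_simp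
    rw [Stirling.log_stirlingSeq_formula, h1, log_div (by positivity) hN'.ne',
      log_div hN'.ne' (exp_pos 1).ne', log_exp, log_mul two_ne_zero hN'.ne']
    ring
  have hval := tendsto_nhds_unique hlim (hlim2.congr' heq)
  rw [log_barnesG_one_add (by norm_num), hval, log_sqrt pi_pos.le,
    log_mul two_ne_zero pi_ne_zero]
  ring

lemma hasDerivAt_log_barnesG_one_add {t : ℝ} (ht : 0 < t) :
    HasDerivAt (fun s => log (barnesG (1 + s)))
      (1 / 2 * log (2 * π) - t + t * log t - t * binetIntegral t) t := by
  have ht' : -(1 / 2) < t := by linarith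
  have hev : (fun s => log (barnesG (1 + s))) =ᶠ[𝓝 t] fun s => s / 2 * log (2 * π) -
      1 / 2 * (eulerMascheroniConstant * s ^ 2 + s ^ 2 + s) + ∑' n, logBarnesGFactor n s := by
    filter_upwards [Ioi_mem_nhds ht'] with s hs using log_barnesG_one_add hs
  refine HasDerivAt.congr_of_eventuallyEq ?_ hev
  have h1 : HasDerivAt (fun s : ℝ => s) 1 t := hasDerivAt_id t
  have h2 : HasDerivAt (fun s : ℝ => s ^ 2) (2 * t) t := by simpa using hasDerivAt_pow 2 t
  have h := (((h1.div_const 2).mul_const (log (2 * π))).sub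
    (((h2.const_mul eulerMascheroniConstant).add h2 |>.add h1).const_mul (1 / 2))).add
    (logBarnesGFactor_series ht').2
  convert! h using 1
  rw [tsum_mul_left, (hasSum_one_div_sub_one_div ht).tsum_eq]
  field_simp
  ring

lemma continuousOn_log_barnesG_one_add : ContinuousOn (fun s => log (barnesG (1 + s))) (Ici 0) := by
  have h : ContinuousOn (fun s => s / 2 * log (2 * π) -
      1 / 2 * (eulerMascheroniConstant * s ^ 2 + s ^ 2 + s) + ∑' n, logBarnesGFactor n s)
      (Ici 0) := by
    refine ContinuousOn.add (by fun_prop) fun s (hs : 0 ≤ s) => ?_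
    exact (logBarnesGFactor_series (by linarith)).2.continuousAt.continuousWithinAt
  exact h.congr fun s (hs : 0 ≤ s) => log_barnesG_one_add (by linarith)

lemma abs_log_sq_add_sq_le {t x : ℝ} (hx : 0 < x) :
    |log (t ^ 2 + x ^ 2)| ≤ 2 * |log x| + (t ^ 2 + x ^ 2) := by
  have hp : 0 < t ^ 2 + x ^ 2 := by positivity
  have h1 : log (t ^ 2 + x ^ 2) ≤ t ^ 2 + x ^ 2 := log_le_self hp.le
  have h2 : 2 * log x ≤ log (t ^ 2 + x ^ 2) := by
    rw [← Nat.cast_ofNat (R := ℝ) (n := 2), ← log_pow]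
    exact log_le_log (by positivity) (by nlinarith)
  rw [abs_le]
  constructor <;> linarith [neg_abs_le (log x), abs_nonneg (log x)]

lemma integrableOn_logSqAddSq_bound (T : ℝ) :
    IntegrableOn (fun x => 2 * |x * log x * planckWeight x| +
      (T ^ 2 * rexp (-π * x) + x ^ 2 * rexp (-π * x))) (Ioi 0) := by
  refine (integrableOn_mul_log_mul_planckWeight.abs.const_mul 2).add
    (((integrableOn_exp_mul_Ioi (neg_lt_zero.2 pi_pos) 0).const_mul _).add ?_)
  have := integrableOn_rpow_mul_exp_neg_mul_rpow (s := 2) (p := 1) (b := π) (by norm_num)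
    one_pos pi_pos
  simpa [IntegrableOn] using this

lemma norm_mul_log_sq_add_sq_mul_planckWeight_le {t T x : ℝ} (ht : 0 ≤ t) (htT : t ≤ T)
    (hx : 0 < x) :
    ‖x * log (t ^ 2 + x ^ 2) * planckWeight x‖ ≤ 2 * |x * log x * planckWeight x| +
      (T ^ 2 * rexp (-π * x) + x ^ 2 * rexp (-π * x)) := by
  have hw := planckWeight_pos hx
  have h1 := mul_le_mul_of_nonneg_left (abs_log_sq_add_sq_le (t := t) hx) (mul_pos hx hw).le
  have h2 : t ^ 2 ≤ T ^ 2 := by gcongr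
  have h3 : x * planckWeight x * (t ^ 2 + x ^ 2) ≤ rexp (-π * x) * (T ^ 2 + x ^ 2) := by
    gcongr
    exact mul_planckWeight_le hx
  rw [norm_eq_abs, abs_mul, abs_mul, abs_mul, abs_mul, abs_of_pos hx, abs_of_pos hw]
  linarith

lemma measurable_mul_log_sq_add_sq_mul_planckWeight (t : ℝ) :
    Measurable fun x => x * log (t ^ 2 + x ^ 2) * planckWeight x := by
  have := measurable_planckWeight
  fun_prop

lemma integrableOn_mul_log_sq_add_sq_mul_planckWeight {t : ℝ} (ht : 0 ≤ t) :
    IntegrableOn (fun x => x * log (t ^ 2 + x ^ 2) * planckWeight x) (Ioi 0) :=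
  Integrable.mono' (integrableOn_logSqAddSq_bound t)
    (measurable_mul_log_sq_add_sq_mul_planckWeight t).aestronglyMeasurable
    ((ae_restrict_mem measurableSet_Ioi).mono fun _ hx =>
      norm_mul_log_sq_add_sq_mul_planckWeight_le ht le_rfl hx)

/-- The integral `∫ x log (t² + x²) / (e ^ (2πx) - 1)` over the positive half-line. -/
noncomputable def logPlanckIntegral (t : ℝ) : ℝ :=
  ∫ x in Ioi (0 : ℝ), x * log (t ^ 2 + x ^ 2) * planckWeight x

lemma continuousOn_logPlanckIntegral (T : ℝ) : ContinuousOn logPlanckIntegral (Icc 0 T) := by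
  refine continuousOn_of_dominated
    (fun t _ => (measurable_mul_log_sq_add_sq_mul_planckWeight t).aestronglyMeasurable)
    (fun t ht => (ae_restrict_mem measurableSet_Ioi).mono fun x hx =>
      norm_mul_log_sq_add_sq_mul_planckWeight_le ht.1 ht.2 hx)
    (integrableOn_logSqAddSq_bound T) ?_
  refine (ae_restrict_mem measurableSet_Ioi).mono fun x (hx : 0 < x) => ?_
  refine ((continuousOn_const.mul (ContinuousOn.log (by fun_prop) fun t _ => ?_)).mul
    continuousOn_const)
  positivity

lemma hasDerivAt_logPlanckIntegral {t : ℝ} (ht : 0 < t) :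
    HasDerivAt logPlanckIntegral (t * binetIntegral t) t := by
  have h := (hasDerivAt_integral_of_dominated_loc_of_deriv_le (μ := volume.restrict (Ioi 0))
    (F := fun t x => x * log (t ^ 2 + x ^ 2) * planckWeight x)
    (F' := fun t x => x * (2 * t / (t ^ 2 + x ^ 2)) * planckWeight x)
    (bound := fun x => 4 / t * (x * planckWeight x)) (s := Ioi (t / 2))
    (Ioi_mem_nhds (half_lt_self ht))
    (Eventually.of_forall fun s =>
      (measurable_mul_log_sq_add_sq_mul_planckWeight s).aestronglyMeasurable)
    (integrableOn_mul_log_sq_add_sq_mul_planckWeight ht.le) ?_ ?_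
    (integrableOn_mul_planckWeight.const_mul _) ?_).2
  · convert! h using 1
    rw [binetIntegral, ← integral_const_mul]
    congr 1 with x
    ring
  · have := measurable_planckWeight
    exact Measurable.aestronglyMeasurable (by fun_prop)
  · refine (ae_restrict_mem measurableSet_Ioi).mono fun x (hx : 0 < x) s (hs : t / 2 < s) => ?_
    have hw := planckWeight_pos hx
    have hs0 : 0 < s := by linarith
    rw [norm_of_nonneg (by positivity)]
    have h1 : 2 * s / (s ^ 2 + x ^ 2) ≤ 4 / t := by
      rw [div_le_div_iff₀ (by positivity) ht]
      nlinarith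
    calc x * (2 * s / (s ^ 2 + x ^ 2)) * planckWeight x ≤ x * (4 / t) * planckWeight x := by
          gcongr
      _ = _ := by ring
  · refine (ae_restrict_mem measurableSet_Ioi).mono fun x (hx : 0 < x) s _ => ?_
    have h2 : HasDerivAt (fun s : ℝ => s ^ 2 + x ^ 2) (2 * s) s := by
      simpa using (hasDerivAt_pow 2 s).add_const (x ^ 2)
    exact ((h2.log (by positivity)).const_mul x).mul_const _

lemma logPlanckIntegral_zero :
    logPlanckIntegral 0 = 2 * ∫ x in Ioi (0 : ℝ), x * log x * planckWeight x := by
  rw [logPlanckIntegral, ← integral_const_mul]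
  congr 1 with x
  rw [zero_pow two_ne_zero, zero_add, log_pow]
  push_cast
  ring

theorem log_barnesG_one_add_eq_integral {t : ℝ} (ht : 0 ≤ t) :
    log (barnesG (1 + t)) = 1 / 2 * t ^ 2 * (log t - 3 / 2) + 1 / 2 * t * log (2 * π) +
      2 * (∫ x in Ioi (0 : ℝ), x * log x * planckWeight x) - logPlanckIntegral t := by
  set H : ℝ → ℝ := fun t => log (barnesG (1 + t)) -
    (1 / 2 * t * (t * log t) - 3 / 4 * t ^ 2 + 1 / 2 * t * log (2 * π) - logPlanckIntegral t)
    with hH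
  have hH0 : H 0 = 2 * ∫ x in Ioi (0 : ℝ), x * log x * planckWeight x := by
    simp only [hH]
    rw [log_barnesG_one, logPlanckIntegral_zero]
    ring
  suffices hHt : H t = H 0 by
    rw [hH0] at hHt
    simp only [hH] at hHt
    linarith
  rcases ht.eq_or_lt with rfl | ht
  · rfl
  have hc : ContinuousOn H (Icc 0 t) := by
    have hml := continuous_mul_log
    exact (continuousOn_log_barnesG_one_add.mono Icc_subset_Ici_self).sub
      (ContinuousOn.sub (Continuous.continuousOn (by fun_prop)) (continuousOn_logPlanckIntegral t))
  have hd : ∀ s ∈ Ioo 0 t, HasDerivAt H 0 s := by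
    rintro s ⟨hs, -⟩
    have h1 : HasDerivAt (fun s : ℝ => s) 1 s := hasDerivAt_id s
    have h2 : HasDerivAt (fun s : ℝ => s ^ 2) (2 * s) s := by simpa using hasDerivAt_pow 2 s
    have h := (hasDerivAt_log_barnesG_one_add hs).sub
      (((((h1.const_mul (1 / 2)).mul (hasDerivAt_mul_log hs.ne')).sub (h2.const_mul (3 / 4))).add
        ((h1.const_mul (1 / 2)).mul_const (log (2 * π)))).sub (hasDerivAt_logPlanckIntegral hs))
    convert! h using 1
    ring
  obtain ⟨c, -, h⟩ := exists_hasDerivAt_eq_slope H (fun _ => 0) ht hc hd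
  rw [eq_div_iff (by linarith)] at h
  linarith

theorem mainTheorem4 :
    (∀ t : ℝ, 0 ≤ t →
      Multipliable (barnesGFactor t) ∧
      0 < barnesG (1 + t) ∧
      MeasureTheory.IntegrableOn
        (fun x : ℝ => x * Real.log (t ^ 2 + x ^ 2) / (Real.exp (2 * Real.pi * x) - 1))
        (Set.Ioi 0) ∧
      ((Real.log (barnesG (1 + t)) : ℝ) : ℂ) =
        ((1 / 2 * t ^ 2 * (Real.log t - 3 / 2) + 1 / 2 * t * Real.log (2 * Real.pi) : ℝ) : ℂ)
          + deriv riemannZeta (-1)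
          - ((∫ x in Set.Ioi (0 : ℝ),
              x * Real.log (t ^ 2 + x ^ 2) / (Real.exp (2 * Real.pi * x) - 1) : ℝ) : ℂ)) ∧
    ((∫ x in Set.Ioi (0 : ℝ),
        x * Real.log (1 + x ^ 2) / (Real.exp (2 * Real.pi * x) - 1) : ℝ) : ℂ) =
      ((1 / 2 * Real.log (2 * Real.pi) : ℝ) : ℂ) + deriv riemannZeta (-1) - 3 / 4 := by
  refine ⟨fun t ht => ⟨multipliable_barnesGFactor (by linarith), barnesG_one_add_pos (by linarith),
    integrableOn_mul_log_sq_add_sq_mul_planckWeight ht, ?_⟩, ?_⟩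
  · rw [log_barnesG_one_add_eq_integral ht, deriv_riemannZeta_neg_one]
    change _ = _ + _ - ((logPlanckIntegral t : ℝ) : ℂ)
    push_cast
    ring
  · have h := log_barnesG_one_add_eq_integral zero_le_one
    rw [log_barnesG_two, logPlanckIntegral, log_one, one_pow] at h
    rw [deriv_riemannZeta_neg_one]
    change ((∫ x in Ioi (0 : ℝ), x * log (1 + x ^ 2) * planckWeight x : ℝ) : ℂ) = _
    have h' : ∫ x in Ioi (0 : ℝ), x * log (1 + x ^ 2) * planckWeight x =
        1 / 2 * log (2 * π) + 2 * (∫ x in Ioi (0 : ℝ), x * log x * planckWeight x) - 3 / 4 := by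
      linarith
    rw [h']
    push_cast
    ring
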